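/- There are $m\ge 2$ tasks and $n\ge 1$ resources. An allocation assigns every task to one resource; $x_i$ denotes the load of resource $i$, i.e. the number of tasks assigned to it. The allocation is a Nash equilibrium if $|x_i-x_j|\le 1$ for all resources $i,j$. Consider the following randomized protocol, run in synchronous rounds. In each round, given the current loads $x_1,\dots,x_n$, all tasks act in parallel, independently of each other and (given the current allocation) of the past: a task currently on resource $i$ chooses a resource $j\in\{1,\dots,n\}$ uniformly at random and, if $x_i>x_j+1$, moves to $j$ with probability $1-x_j/x_i$; otherwise (and with the remaining probability) it stays on $i$. Let $T$ be the number of rounds until the allocation is a Nash equilibrium for the first time. Then $\mathbb{E}[T]=O(\log\log m+n^4)$: there is an absolute constant $C>0$ such that for all $n\ge 1$, all $m\ge 2$ and every (deterministic or random) initial allocation, $$\mathbb{E}[T]\le C\,(\log\log m+n^4),$$ where $\log$ is the natural logarithm. In particular $T<\infty$ almost surely. -/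

import Mathlib

open MeasureTheory
open scoped ENNReal

namespace SelfishLoadBalancing

/-- An allocation of `m` tasks to `n` resources: task `b` currently uses resource `a b`. -/
abbrev Alloc (m n : ℕ) := Fin m → Fin n

/-- The load vector `(x_1, …, x_n)` of an allocation: `x_i` is the number of tasks on `i`. -/
def load {m n : ℕ} (a : Alloc m n) (i : Fin n) : ℕ :=
  (Finset.univ.filter fun b => a b = i).card

/-- A load vector is a Nash equilibrium if any two loads differ by at most one. -/
def IsNash {n : ℕ} (x : Fin n → ℕ) : Prop :=
  ∀ i j, |(x i : ℤ) - (x j : ℤ)| ≤ 1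

/-- The probability that a task on resource `i` selects resource `j` (uniformly, probability
`1 / n`) and then actually migrates there: it does so with probability `1 - x_j / x_i` if
`x_i > x_j + 1`, and never otherwise (neutral moves are disallowed). -/
noncomputable def migrateProb {n : ℕ} (x : Fin n → ℕ) (i j : Fin n) : ℝ :=
  if x j + 1 < x i then 1 / (n : ℝ) * (1 - (x j : ℝ) / (x i : ℝ)) else 0

/-- The probability `p_{i,j}(x)` that a task which is on resource `i` in the current round is on
resource `j` in the next round, when the current loads are `x`. -/
noncomputable def taskProb {n : ℕ} (x : Fin n → ℕ) (i j : Fin n) : ℝ :=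
  if i = j then 1 - ∑ k ∈ Finset.univ.erase i, migrateProb x i k else migrateProb x i j

/-- The transition probability of one round: given the current allocation `a`, all tasks act in
parallel and independently of each other. -/
noncomputable def stepProb {m n : ℕ} (a a' : Alloc m n) : ℝ :=
  ∏ b, taskProb (load a) (a b) (a' b)

/-- `A 0, A 1, …` is a run of the protocol: a Markov chain on allocations with one-round transition
probabilities `stepProb`. The initial allocation is arbitrary (possibly random). -/
structure IsProtocolRun {m n : ℕ} {Ω : Type*} [MeasurableSpace Ω] (μ : Measure Ω)
    (A : ℕ → Ω → Alloc m n) : Prop where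
  measurable : ∀ t, Measurable (A t)
  markov : ∀ (t : ℕ) (h : ℕ → Alloc m n) (a' : Alloc m n),
    μ.real {ω | (∀ s ≤ t, A s ω = h s) ∧ A (t + 1) ω = a'} =
      μ.real {ω | ∀ s ≤ t, A s ω = h s} * stepProb (h t) a'

/-- The number of rounds until the allocation is a Nash equilibrium for the first time
(`∞` if this never happens). -/
noncomputable def nashTime {m n : ℕ} {Ω : Type*} (A : ℕ → Ω → Alloc m n) (ω : Ω) : ℝ≥0∞ :=
  ⨅ (t : ℕ) (_ : IsNash (load (A t ω))), (t : ℝ≥0∞)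

end SelfishLoadBalancing

/-!
The potential `∑ (x_i - x̄) ^ 2` of the loads is followed through one round. Given the allocation,
the new load of a resource is a sum of independent indicators. If neutral moves were allowed its
mean would be exactly the average load `x̄`, so what is left after a round is the variance, which is
at most the expected traffic, plus a small bias stemming from the forbidden neutral moves. This
gives two estimates for the expected new potential: it is at most `n + √(2 n Φ)`
(`expect_potential_le_sqrt`), and it never exceeds the old potential `Φ`, with a drop of at least
`2 / n ^ 2` outside equilibrium (`expect_potential_le_of_not_isSplit`), except in *split* states,
where all loads are `k` or `k + 2`. All loads of a split state have the same parity, and the moves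
of the tasks make parities random, so that a split state is left with probability at least
`1 / (2 n)` (`expect_splitIndicator_le`). Hence `Φ + 1_split / n ^ 2` drops by `1 / (2 n ^ 3)` in
expectation in every round outside equilibrium.

Cut off at `256 n` and multiplied by `2 n ^ 3`, this quantity is at most of order `n ^ 4` and drops
by one per round while `Φ` is of order `n`; above the cutoff it does not increase. By the square
root estimate, `log (1 + log (1 + Φ / n))` drops by a constant per round while `Φ` is larger, and by
concavity it never increases in expectation; it is at most `log log m + O(1)`. The sum of the two,
`lyapunov`, thus drops by one in expectation in every round outside equilibrium
(`expect_lyapunov_le`), and its maximum bounds the expected hitting time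
(`IsProtocolRun.lintegral_nashTime_le`).
-/

namespace SelfishLoadBalancing

variable {m n : ℕ}

/-! ### One round of the protocol -/

lemma migrateProb_nonneg (x : Fin n → ℕ) (i j : Fin n) : 0 ≤ migrateProb x i j := by
  unfold migrateProb
  split_ifs with h
  · have : (x j : ℝ) / x i ≤ 1 := by
      apply div_le_one_of_le₀ _ (Nat.cast_nonneg _)
      exact_mod_cast (by omega : x j ≤ x i)
    exact mul_nonneg (by positivity) (by linarith)
  · exact le_rfl

lemma migrateProb_le (x : Fin n → ℕ) (i j : Fin n) : migrateProb x i j ≤ 1 / n := by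
  unfold migrateProb
  split_ifs with h
  · exact mul_le_of_le_one_right (by positivity) 
      (by linarith [show 0 ≤ (x j : ℝ) / x i by positivity])
  · positivity

lemma migrateProb_self (x : Fin n → ℕ) (i : Fin n) : migrateProb x i i = 0 := by
  simp [migrateProb]

lemma sum_migrateProb_erase (x : Fin n → ℕ) (i : Fin n) :
    ∑ k ∈ Finset.univ.erase i, migrateProb x i k = ∑ k, migrateProb x i k :=
  Finset.sum_erase _ (migrateProb_self x i)

lemma sum_migrateProb_le_one (x : Fin n → ℕ) (i : Fin n) : ∑ k, migrateProb x i k ≤ 1 := by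
  have hn : (n : ℝ) ≠ 0 := by
    have := i.pos
    positivity
  calc ∑ k, migrateProb x i k ≤ ∑ _k : Fin n, (1 / n : ℝ) :=
        Finset.sum_le_sum fun k _ => migrateProb_le x i k
    _ = 1 := by simp [hn]

lemma taskProb_self (x : Fin n → ℕ) (i : Fin n) :
    taskProb x i i = 1 - ∑ k, migrateProb x i k := by
  simp [taskProb, migrateProb_self]

lemma taskProb_of_ne (x : Fin n → ℕ) {i j : Fin n} (h : i ≠ j) :
    taskProb x i j = migrateProb x i j := by
  simp [taskProb, h]

lemma taskProb_nonneg (x : Fin n → ℕ) (i j : Fin n) : 0 ≤ taskProb x i j := by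
  by_cases h : i = j
  · subst h
    rw [taskProb_self]
    linarith [sum_migrateProb_le_one x i]
  · rw [taskProb_of_ne x h]
    exact migrateProb_nonneg x i j

lemma sum_taskProb (x : Fin n → ℕ) (i : Fin n) : ∑ j, taskProb x i j = 1 := by
  rw [← Finset.add_sum_erase _ _ (Finset.mem_univ i), taskProb_self, ← sum_migrateProb_erase]
  rw [Finset.sum_congr rfl fun j hj => taskProb_of_ne x (Finset.ne_of_mem_erase hj).symm]
  ring

lemma taskProb_le_one (x : Fin n → ℕ) (i j : Fin n) : taskProb x i j ≤ 1 := by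
  rw [← sum_taskProb x i]
  exact Finset.single_le_sum (fun k _ => taskProb_nonneg x i k) (Finset.mem_univ j)

lemma stepProb_nonneg (a a' : Alloc m n) : 0 ≤ stepProb a a' :=
  Finset.prod_nonneg fun _ _ => taskProb_nonneg _ _ _

/-- The expectation of `f` of the allocation reached from `a` in one round. -/
noncomputable def expect (a : Alloc m n) (f : Alloc m n → ℝ) : ℝ := ∑ a', stepProb a a' * f a'

/-- Independence of the tasks: the expectation of a product over the tasks factorizes. -/
lemma expect_prod (a : Alloc m n) (f : Fin m → Fin n → ℝ) :
    expect a (fun a' => ∏ b, f b (a' b)) = ∏ b, ∑ j, taskProb (load a) (a b) j * f b j := by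
  simp only [expect, stepProb, ← Finset.prod_mul_distrib]
  rw [Finset.prod_univ_sum, Fintype.piFinset_univ]

lemma expect_one (a : Alloc m n) : expect a (fun _ => 1) = 1 := by
  have := expect_prod a (fun _ _ => 1)
  simpa [sum_taskProb] using this

lemma sum_stepProb (a : Alloc m n) : ∑ a', stepProb a a' = 1 := by
  simpa [expect] using expect_one a

lemma expect_add (a : Alloc m n) (f g : Alloc m n → ℝ) :
    expect a (fun a' => f a' + g a') = expect a f + expect a g := by
  simp [expect, mul_add, Finset.sum_add_distrib]

lemma expect_const_mul (a : Alloc m n) (c : ℝ) (f : Alloc m n → ℝ) :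
    expect a (fun a' => c * f a') = c * expect a f := by
  simp only [expect, Finset.mul_sum]
  exact Finset.sum_congr rfl fun _ _ => by ring

lemma expect_const (a : Alloc m n) (c : ℝ) : expect a (fun _ => c) = c := by
  simpa [expect_one] using expect_const_mul a c (fun _ => 1)

lemma expect_sum {ι : Type*} (s : Finset ι) (a : Alloc m n) (f : ι → Alloc m n → ℝ) :
    expect a (fun a' => ∑ i ∈ s, f i a') = ∑ i ∈ s, expect a (f i) := by
  simp only [expect, Finset.mul_sum]
  exact Finset.sum_comm

lemma expect_mono (a : Alloc m n) {f g : Alloc m n → ℝ} (h : ∀ a', f a' ≤ g a') :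
    expect a f ≤ expect a g :=
  Finset.sum_le_sum fun a' _ => mul_le_mul_of_nonneg_left (h a') (stepProb_nonneg a a')

/-- Jensen's inequality for one round. -/
lemma expect_le_of_concaveOn {s : Set ℝ} {g : ℝ → ℝ} (hg : ConcaveOn ℝ s g) (a : Alloc m n)
    {f : Alloc m n → ℝ} (hf : ∀ a', f a' ∈ s) :
    expect a (fun a' => g (f a')) ≤ g (expect a f) := by
  simpa [expect] using hg.le_map_sum (t := Finset.univ) (w := stepProb a) (p := f)
    (fun a' _ => stepProb_nonneg a a') (sum_stepProb a) (fun a' _ => hf a')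

/-! ### Moments of the loads -/

lemma expect_indicator (a : Alloc m n) (b : Fin m) (i : Fin n) :
    expect a (fun a' => if a' b = i then 1 else 0) = taskProb (load a) (a b) i := by
  have h := expect_prod a (fun c j => if c = b then (if j = i then 1 else 0) else 1)
  simp only [Finset.prod_ite_eq', Finset.mem_univ, if_true] at h
  rw [h, ← Finset.mul_prod_erase _ _ (Finset.mem_univ b), Finset.prod_eq_one]
  · simp
  · intro c hc
    simp [Finset.ne_of_mem_erase hc, sum_taskProb]

lemma expect_indicator_mul (a : Alloc m n) {b c : Fin m} (hbc : b ≠ c) (i : Fin n) :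
    expect a (fun a' => (if a' b = i then 1 else 0) * (if a' c = i then 1 else 0)) =
      taskProb (load a) (a b) i * taskProb (load a) (a c) i := by
  have h := expect_prod a (fun d j => (if d = b then (if j = i then 1 else 0) else 1) *
    (if d = c then (if j = i then 1 else 0) else 1))
  simp only [Finset.prod_mul_distrib, Finset.prod_ite_eq', Finset.mem_univ, if_true] at h
  rw [h, ← Finset.mul_prod_erase _ _ (Finset.mem_univ b),
    ← Finset.mul_prod_erase _ _ (Finset.mem_erase.2 ⟨hbc.symm, Finset.mem_univ c⟩),
    Finset.prod_eq_one]
  · simp [hbc, hbc.symm]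
  · intro d hd
    simp only [Finset.mem_erase] at hd
    simp [hd.1, hd.2.1, sum_taskProb]

lemma cast_load (a : Alloc m n) (i : Fin n) :
    (load a i : ℝ) = ∑ b, if a b = i then 1 else 0 := by
  simp [load]

lemma sum_comp_eq_sum_load (a : Alloc m n) (F : Fin n → ℝ) :
    ∑ b, F (a b) = ∑ k, (load a k : ℝ) * F k := by
  simp only [cast_load, Finset.sum_mul]
  rw [Finset.sum_comm]
  simp

lemma sum_load (a : Alloc m n) : ∑ k, (load a k : ℝ) = m := by
  simpa using (sum_comp_eq_sum_load a (fun _ => 1)).symm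

/-- The expected load of resource `i` after one round from the loads `x`. -/
noncomputable def meanLoad (x : Fin n → ℕ) (i : Fin n) : ℝ := ∑ k, (x k : ℝ) * taskProb x k i

/-- The load after one round is a sum of independent indicators: its second moment is the square
of its mean plus its variance. -/
lemma expect_load_sq (a : Alloc m n) (i : Fin n) :
    expect a (fun a' => (load a' i : ℝ) ^ 2) =
      meanLoad (load a) i ^ 2 +
        ∑ k, (load a k : ℝ) * (taskProb (load a) k i * (1 - taskProb (load a) k i)) := by
  rw [← sum_comp_eq_sum_load a (fun k => taskProb (load a) k i * (1 - taskProb (load a) k i)),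
    meanLoad, ← sum_comp_eq_sum_load a (fun k => taskProb (load a) k i)]
  simp only [cast_load, sq, Finset.sum_mul_sum, expect_sum]
  rw [← Finset.sum_add_distrib]
  refine Finset.sum_congr rfl fun b _ => ?_
  rw [← Finset.add_sum_erase _ _ (Finset.mem_univ b),
    ← Finset.add_sum_erase _ (fun c => taskProb (load a) (a b) i * taskProb (load a) (a c) i)
      (Finset.mem_univ b),
    Finset.sum_congr rfl fun c hc => expect_indicator_mul a (Finset.ne_of_mem_erase hc).symm i]
  have : expect a (fun a' => (if a' b = i then (1 : ℝ) else 0) * (if a' b = i then 1 else 0)) =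
      taskProb (load a) (a b) i := by
    rw [← expect_indicator a b i]
    congr 1
    ext a'
    split_ifs <;> simp
  rw [this]
  ring

/-- The expected number of tasks moving from `i` to `j` in one round. -/
noncomputable def flow (x : Fin n → ℕ) (i j : Fin n) : ℝ :=
  if x j + 1 < x i then ((x i : ℝ) - x j) / n else 0

lemma load_mul_migrateProb (x : Fin n → ℕ) (i j : Fin n) :
    (x i : ℝ) * migrateProb x i j = flow x i j := by
  unfold migrateProb flow
  split_ifs with h
  · have : (x i : ℝ) ≠ 0 := by
      have : 0 < x i := by omega
      positivity
    field_simp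
  · simp

lemma flow_self (x : Fin n → ℕ) (i : Fin n) : flow x i i = 0 := by simp [flow]

lemma meanLoad_eq (x : Fin n → ℕ) (i : Fin n) :
    meanLoad x i = x i + ∑ k, (flow x k i - flow x i k) := by
  have h : ∑ k ∈ Finset.univ.erase i, (x k : ℝ) * taskProb x k i = ∑ k, flow x k i := by
    rw [← Finset.sum_erase (f := fun k => flow x k i) _ (flow_self x i)]
    refine Finset.sum_congr rfl fun k hk => ?_
    rw [taskProb_of_ne x (Finset.ne_of_mem_erase hk), load_mul_migrateProb]
  rw [meanLoad, ← Finset.add_sum_erase _ _ (Finset.mem_univ i), h, taskProb_self, mul_sub,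
    Finset.mul_sum, Finset.sum_sub_distrib]
  simp only [load_mul_migrateProb]
  ring

/-- The variance of the load of `i` is at most the expected traffic through `i`. -/
lemma variance_le (x : Fin n → ℕ) (i : Fin n) :
    ∑ k, (x k : ℝ) * (taskProb x k i * (1 - taskProb x k i)) ≤
      ∑ k, (flow x k i + flow x i k) := by
  rw [← Finset.add_sum_erase _ _ (Finset.mem_univ i), Finset.sum_add_distrib, add_comm]
  apply add_le_add
  · rw [← Finset.sum_erase (f := fun k => flow x k i) _ (flow_self x i)]
    refine Finset.sum_le_sum fun k hk => ?_
    rw [taskProb_of_ne x (Finset.ne_of_mem_erase hk), ← load_mul_migrateProb]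
    refine mul_le_mul_of_nonneg_left ?_ (Nat.cast_nonneg _)
    nlinarith [sq_nonneg (migrateProb x k i)]
  · simp only [← load_mul_migrateProb, ← Finset.mul_sum]
    refine mul_le_mul_of_nonneg_left ?_ (Nat.cast_nonneg _)
    have := taskProb_self x i
    nlinarith [taskProb_le_one x i i]

/-! ### The potential and its expected change -/

/-- The potential of a load vector: the sum of the squared deviations of the loads from their
mean, written as a sum over pairs. -/
noncomputable def potential (x : Fin n → ℕ) : ℝ :=
  1 / (2 * n) * ∑ i, ∑ j, ((x i : ℝ) - x j) ^ 2

lemma potential_nonneg (x : Fin n → ℕ) : 0 ≤ potential x := by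
  unfold potential
  positivity

lemma potential_eq (hn : 0 < n) (x : Fin n → ℕ) :
    potential x = ∑ i, (x i : ℝ) ^ 2 - (∑ i, (x i : ℝ)) ^ 2 / n := by
  have hn' : (n : ℝ) ≠ 0 := by positivity
  have h : ∑ i, ∑ j, ((x i : ℝ) - x j) ^ 2 =
      2 * n * ∑ i, (x i : ℝ) ^ 2 - 2 * (∑ i, (x i : ℝ)) ^ 2 := by
    simp only [sub_sq, Finset.sum_add_distrib, Finset.sum_sub_distrib, ← Finset.mul_sum,
      ← Finset.sum_mul, Finset.sum_const, Finset.card_univ, Fintype.card_fin, nsmul_eq_mul]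
    ring
  rw [potential, h]
  field_simp

/-- The number of resources whose load exceeds that of `i` by exactly one. -/
def above (x : Fin n → ℕ) (i : Fin n) : ℕ := (Finset.univ.filter fun l => x l = x i + 1).card

/-- The number of resources whose load is exactly one less than that of `i`. -/
def below (x : Fin n → ℕ) (i : Fin n) : ℕ := (Finset.univ.filter fun l => x i = x l + 1).card

lemma cast_above (x : Fin n → ℕ) (i : Fin n) :
    (above x i : ℝ) = ∑ l, if x l = x i + 1 then 1 else 0 := by simp [above]

lemma cast_below (x : Fin n → ℕ) (i : Fin n) :
    (below x i : ℝ) = ∑ l, if x i = x l + 1 then 1 else 0 := by simp [below]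

lemma sum_below (x : Fin n → ℕ) : ∑ i, (below x i : ℝ) = ∑ i, (above x i : ℝ) := by
  simp only [cast_above, cast_below]
  exact Finset.sum_comm

lemma above_le (x : Fin n → ℕ) (i : Fin n) : above x i ≤ n := by
  simpa [above] using Finset.card_le_univ (Finset.univ.filter fun l => x l = x i + 1)

lemma below_le (x : Fin n → ℕ) (i : Fin n) : below x i ≤ n := by
  simpa [below] using Finset.card_le_univ (Finset.univ.filter fun l => x i = x l + 1)

lemma above_add_below_le (x : Fin n → ℕ) {i l : Fin n} (h : x l = x i + 1) :
    above x i + below x l ≤ n := by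
  unfold above below
  rw [← Finset.card_union_of_disjoint]
  · simpa using Finset.card_le_univ (α := Fin n) _
  · rw [Finset.disjoint_filter]
    intro k _ h1 h2
    omega

/-- If neutral moves were allowed, every mean load would be the average load; forbidding them
shifts it by the neighbouring levels only. -/
lemma mul_meanLoad (hn : 0 < n) (x : Fin n → ℕ) (i : Fin n) :
    n * meanLoad x i = ∑ k, (x k : ℝ) - (above x i - below x i) := by
  have hn' : (n : ℝ) ≠ 0 := by positivity
  have h : ∀ k, n * (flow x k i - flow x i k) = ((x k : ℝ) - x i) -
      (if x k = x i + 1 then 1 else 0) + (if x i = x k + 1 then 1 else 0) := by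
    intro k
    unfold flow
    rcases lt_trichotomy (x k) (x i) with h | h | h
    · rw [if_neg (c := x i + 1 < x k) (by omega), if_neg (c := x k = x i + 1) (by omega)]
      by_cases h' : x i = x k + 1
      · rw [if_neg (by omega), if_pos h', h']
        push_cast
        ring
      · rw [if_pos (by omega), if_neg h']
        field_simp
        ring
    · rw [if_neg (by omega), if_neg (by omega), if_neg (by omega), if_neg (by omega), h]
      ring
    · rw [if_neg (c := x k + 1 < x i) (by omega), if_neg (c := x i = x k + 1) (by omega)]
      by_cases h' : x k = x i + 1
      · rw [if_neg (by omega), if_pos h', h']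
        push_cast
        ring
      · rw [if_pos (by omega), if_neg h']
        field_simp
        ring
  rw [meanLoad_eq, mul_add, Finset.mul_sum, Finset.sum_congr rfl fun k _ => h k, cast_above,
    cast_below]
  simp only [Finset.sum_add_distrib, Finset.sum_sub_distrib, Finset.sum_const, Finset.card_univ,
    Fintype.card_fin, nsmul_eq_mul]
  ring

lemma expect_potential_le (hn : 0 < n) (a : Alloc m n) :
    expect a (fun a' => potential (load a')) ≤
      1 / (n : ℝ) ^ 2 * ∑ i, ((above (load a) i : ℝ) - below (load a) i) ^ 2 +
        2 * ∑ i, ∑ j, flow (load a) i j := by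
  have hn' : (n : ℝ) ≠ 0 := by positivity
  set x := load a with hx
  have h1 : expect a (fun a' => potential (load a')) =
      ∑ i, expect a (fun a' => (load a' i : ℝ) ^ 2) - (m : ℝ) ^ 2 / n := by
    simp only [potential_eq hn, sum_load, sub_eq_add_neg]
    rw [expect_add, expect_const, expect_sum]
  have h2 : ∑ i, meanLoad x i ^ 2 =
      (m : ℝ) ^ 2 / n + 1 / (n : ℝ) ^ 2 * ∑ i, ((above x i : ℝ) - below x i) ^ 2 := by
    have h : ∀ i, meanLoad x i ^ 2 = (m : ℝ) ^ 2 / n ^ 2 - 2 * m / n ^ 2 * (above x i - below x i)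
        + 1 / (n : ℝ) ^ 2 * ((above x i : ℝ) - below x i) ^ 2 := by
      intro i
      have := mul_meanLoad hn x i
      rw [hx, sum_load, ← hx] at this
      have h3 : meanLoad x i = (m - (above x i - below x i)) / n := by
        rw [← this]; field_simp
      rw [h3]
      field_simp
      ring
    simp only [h, Finset.sum_add_distrib, Finset.sum_sub_distrib, ← Finset.mul_sum, sum_below]
    simp only [Finset.sum_const, Finset.card_univ, Fintype.card_fin, nsmul_eq_mul]
    field_simp
    ring
  have h3 : ∑ i, ∑ k, (flow x k i + flow x i k) = 2 * ∑ i, ∑ j, flow x i j := by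
    simp only [Finset.sum_add_distrib]
    rw [Finset.sum_comm]
    ring
  rw [h1]
  simp only [expect_load_sq, Finset.sum_add_distrib]
  have h4 := Finset.sum_le_sum fun i (_ : i ∈ Finset.univ) => variance_le x i
  rw [h3] at h4
  rw [← hx, h2]
  linarith

/-- Expanding one factor of each square as a sum over the neighbouring level turns the left side
into a sum over pairs of resources on consecutive levels, each weighted by the sizes of its two levels,
which add up to at most `n`. -/
lemma sum_above_sq_add_below_sq_le (x : Fin n → ℕ) :
    ∑ i, ((above x i : ℝ) ^ 2 + (below x i : ℝ) ^ 2) ≤ n * ∑ i, (above x i : ℝ) := by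
  have hA : ∑ i, (above x i : ℝ) ^ 2 =
      ∑ i, ∑ l, (if x l = x i + 1 then 1 else 0) * (above x i : ℝ) := by
    simp only [← Finset.sum_mul, ← cast_above, sq]
  have hB : ∑ i, (below x i : ℝ) ^ 2 =
      ∑ i, ∑ l, (if x l = x i + 1 then 1 else 0) * (below x l : ℝ) := by
    rw [Finset.sum_comm]
    simp only [← Finset.sum_mul, ← cast_below, sq]
  rw [Finset.sum_add_distrib, hA, hB, ← Finset.sum_add_distrib, Finset.mul_sum]
  refine Finset.sum_le_sum fun i _ => ?_
  rw [← Finset.sum_add_distrib, cast_above, Finset.mul_sum]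
  refine Finset.sum_le_sum fun l _ => ?_
  split_ifs with h
  · have : ((above x i + below x l : ℕ) : ℝ) ≤ n := by exact_mod_cast above_add_below_le x h
    push_cast at this
    simpa [cast_above] using this
  · simp

/-- The potential is a supermartingale. Moreover it drops by a definite amount if some three
consecutive levels are occupied or some two loads differ by at least three. -/
lemma expect_potential_add_le (hn : 0 < n) (a : Alloc m n) :
    expect a (fun a' => potential (load a')) +
        2 / (n : ℝ) ^ 2 * ∑ i, (above (load a) i : ℝ) * below (load a) i +
        ∑ i, ∑ j, (if load a j + 3 ≤ load a i then 3 / (2 * n : ℝ) else 0) ≤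
      potential (load a) := by
  have hn' : (0 : ℝ) < n := by positivity
  have h1 := expect_potential_le hn a
  set x := load a
  -- Pair by pair: `d ^ 2 ≥ 2 d` pays for the traffic if the loads differ by `d ≥ 2`, leaving `3` if
  -- `d ≥ 3`; pairs with `d = 1` cause no traffic and pay for the bias.
  have h2 : ∑ i, ∑ j, (flow x i j + flow x j i +
      ((if x j = x i + 1 then 1 else 0) + (if x i = x j + 1 then 1 else 0)) * (1 / (2 * n : ℝ)) +
      (if x j + 3 ≤ x i then 3 / (2 * n : ℝ) else 0)) ≤ potential x := by
    simp only [potential, Finset.mul_sum]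
    refine Finset.sum_le_sum fun i _ => Finset.sum_le_sum fun j _ => ?_
    have key : n * (flow x i j + flow x j i +
      ((if x j = x i + 1 then 1 else 0) + (if x i = x j + 1 then 1 else 0)) * (1 / (2 * n : ℝ)) +
      (if x j + 3 ≤ x i then 3 / (2 * n : ℝ) else 0)) ≤ ((x i : ℝ) - x j) ^ 2 / 2 := by
      unfold flow
      rcases lt_trichotomy (x j) (x i) with h | h | h
      · rw [if_neg (c := x i + 1 < x j) (by omega), if_neg (c := x j = x i + 1) (by omega)]
        obtain ⟨d, hd⟩ : ∃ d, x i = x j + 1 + d := ⟨x i - x j - 1, by omega⟩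
        rcases d with _ | _ | d
        · rw [if_neg (by omega), if_pos (by omega), if_neg (by omega), hd]
          field_simp
          push_cast
          norm_num
        · rw [if_pos (by omega), if_neg (by omega), if_neg (by omega), hd]
          field_simp
          push_cast
          ring_nf
          norm_num
        · rw [if_pos (by omega), if_neg (by omega), if_pos (by omega), hd]
          field_simp
          push_cast
          nlinarith [(Nat.cast_nonneg d : (0 : ℝ) ≤ d)]
      · simp [h]
      · rw [if_neg (c := x j + 1 < x i) (by omega), if_neg (c := x i = x j + 1) (by omega),
          if_neg (c := x j + 3 ≤ x i) (by omega)]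
        obtain ⟨d, hd⟩ : ∃ d, x j = x i + 1 + d := ⟨x j - x i - 1, by omega⟩
        rcases d with _ | d
        · rw [if_neg (by omega), if_pos (by omega), hd]
          field_simp
          push_cast
          norm_num
        · rw [if_pos (by omega), if_neg (by omega), hd]
          field_simp
          push_cast
          nlinarith [(Nat.cast_nonneg d : (0 : ℝ) ≤ d)]
    rw [mul_comm] at key
    calc _ ≤ ((x i : ℝ) - x j) ^ 2 / 2 / n := (le_div_iff₀ hn').2 key
      _ = _ := by field_simp
  simp only [Finset.sum_add_distrib, ← Finset.sum_mul, ← cast_above, ← cast_below, sum_below] at h2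
  rw [Finset.sum_comm (f := fun i j => flow x j i)] at h2
  have h3 := sum_above_sq_add_below_sq_le x
  have h4 : ∑ i, ((above x i : ℝ) - below x i) ^ 2 =
      ∑ i, ((above x i : ℝ) ^ 2 + (below x i : ℝ) ^ 2) - 2 * ∑ i, (above x i : ℝ) * below x i := by
    rw [Finset.mul_sum, ← Finset.sum_sub_distrib]
    exact Finset.sum_congr rfl fun i _ => by ring
  have h5 : 1 / (n : ℝ) ^ 2 * ∑ i, ((above x i : ℝ) - below x i) ^ 2 +
      2 / (n : ℝ) ^ 2 * ∑ i, (above x i : ℝ) * below x i ≤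
      (∑ i, (above x i : ℝ) + ∑ i, (above x i : ℝ)) * (1 / (2 * n)) := by
    rw [h4]
    calc _ = 1 / (n : ℝ) ^ 2 * ∑ i, ((above x i : ℝ) ^ 2 + (below x i : ℝ) ^ 2) := by ring
      _ ≤ 1 / (n : ℝ) ^ 2 * (n * ∑ i, (above x i : ℝ)) := by gcongr
      _ = _ := by field_simp; ring
  linarith

lemma expect_potential_le_self (hn : 0 < n) (a : Alloc m n) :
    expect a (fun a' => potential (load a')) ≤ potential (load a) := by
  have h := expect_potential_add_le hn a
  have h1 : 0 ≤ 2 / (n : ℝ) ^ 2 * ∑ i, (above (load a) i : ℝ) * below (load a) i := by positivity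
  have h2 : 0 ≤ ∑ i, ∑ j, (if load a j + 3 ≤ load a i then 3 / (2 * n : ℝ) else 0) :=
    Finset.sum_nonneg fun i _ => Finset.sum_nonneg fun j _ => by split_ifs <;> positivity
  linarith

/-- Far from equilibrium the potential shrinks to about its square root in one round. -/
lemma expect_potential_le_sqrt (hn : 0 < n) (a : Alloc m n) :
    expect a (fun a' => potential (load a')) ≤ n + √(2 * n * potential (load a)) := by
  have hn' : (0 : ℝ) < n := by positivity
  refine (expect_potential_le hn a).trans ?_
  set x := load a
  refine add_le_add ?_ (Real.le_sqrt_of_sq_le ?_)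
  · have : ∑ i, ((above x i : ℝ) - below x i) ^ 2 ≤ ∑ _i : Fin n, (n : ℝ) ^ 2 := by
      refine Finset.sum_le_sum fun i _ => sq_le_sq' ?_ ?_
      · have : (below x i : ℝ) ≤ n := by exact_mod_cast below_le x i
        linarith [(Nat.cast_nonneg (above x i) : (0 : ℝ) ≤ above x i)]
      · have : (above x i : ℝ) ≤ n := by exact_mod_cast above_le x i
        linarith [(Nat.cast_nonneg (below x i) : (0 : ℝ) ≤ below x i)]
    calc _ ≤ 1 / (n : ℝ) ^ 2 * ∑ _i : Fin n, (n : ℝ) ^ 2 := by gcongr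
      _ = n := by simp; field_simp
  · have h1 : 2 * ∑ i, ∑ j, flow x i j = ∑ i, ∑ j, (flow x i j + flow x j i) := by
      simp only [Finset.sum_add_distrib]
      rw [Finset.sum_comm (f := fun i j => flow x j i)]
      ring
    have hf : ∀ i j, 0 ≤ flow x i j := fun i j => by
      rw [← load_mul_migrateProb]
      exact mul_nonneg (Nat.cast_nonneg _) (migrateProb_nonneg _ _ _)
    have h2 : ∀ i j, (flow x i j + flow x j i) ^ 2 ≤ (((x i : ℝ) - x j) / n) ^ 2 := by
      intro i j
      unfold flow
      split_ifs with h h'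
      · omega
      · simp
      · apply le_of_eq; ring
      · simpa using sq_nonneg _
    rw [h1, ← Fintype.sum_prod_type' (f := fun i j => flow x i j + flow x j i)]
    refine sq_sum_le_card_mul_sum_sq.trans ?_
    rw [Fintype.sum_prod_type (f := fun p : Fin n × Fin n => (flow x p.1 p.2 + flow x p.2 p.1) ^ 2)]
    calc _ ≤ ((Finset.univ : Finset (Fin n × Fin n)).card : ℝ) *
          ∑ i, ∑ j, (((x i : ℝ) - x j) / n) ^ 2 := by
          exact mul_le_mul_of_nonneg_left
            (Finset.sum_le_sum fun i _ => Finset.sum_le_sum fun j _ => h2 i j) (by positivity)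
      _ = _ := by
          simp only [div_pow, ← Finset.sum_div, potential]
          simp
          field_simp

/-! ### Split load vectors -/

/-- A load vector is split if it takes exactly two values and these differ by two. These are the
vectors outside equilibrium on which the potential need not drop in expectation. -/
def IsSplit (x : Fin n → ℕ) : Prop :=
  ∃ k, (∀ l, x l = k ∨ x l = k + 2) ∧ (∃ i, x i = k + 2) ∧ ∃ j, x j = k

lemma two_le_of_not_isNash {x : Fin n → ℕ} (h : ¬ IsNash x) : 2 ≤ n := by
  by_contra! hn
  apply h
  intro i j
  have : i = j := Fin.ext (by omega)
  simp [this]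

lemma exists_of_not_isNash {x : Fin n → ℕ} (h : ¬ IsNash x) : ∃ i j, x j + 2 ≤ x i := by
  unfold IsNash at h
  push Not at h
  obtain ⟨i, j, h⟩ := h
  rcases lt_abs.1 h with h | h
  · exact ⟨i, j, by omega⟩
  · exact ⟨j, i, by omega⟩

lemma expect_potential_le_of_not_isSplit (a : Alloc m n) (h : ¬ IsNash (load a))
    (hs : ¬ IsSplit (load a)) :
    expect a (fun a' => potential (load a')) ≤ potential (load a) - 2 / (n : ℝ) ^ 2 := by
  have hn2 := two_le_of_not_isNash h
  have hn2' : (2 : ℝ) ≤ n := by exact_mod_cast hn2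
  have hd := expect_potential_add_le (by omega) a
  set x := load a
  have hA : ∀ i, 0 ≤ (above x i : ℝ) * below x i := fun i => by positivity
  have hT : ∀ i j, 0 ≤ (if x j + 3 ≤ x i then 3 / (2 * n : ℝ) else 0) := fun i j => by
    split_ifs <;> positivity
  have hA' : 0 ≤ 2 / (n : ℝ) ^ 2 * ∑ i, (above x i : ℝ) * below x i := by positivity
  have hT' : 0 ≤ ∑ i, ∑ j, (if x j + 3 ≤ x i then 3 / (2 * n : ℝ) else 0) :=
    Finset.sum_nonneg fun i _ => Finset.sum_nonneg fun j _ => hT i j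
  -- If no gap of three exists, all loads are among `x j`, `x j + 1`, `x j + 2` for some `j`, and
  -- the middle level is occupied since `x` is not split.
  by_cases h3 : ∃ i j, x j + 3 ≤ x i
  · obtain ⟨i, j, hij⟩ := h3
    have : (if x j + 3 ≤ x i then 3 / (2 * n : ℝ) else 0) ≤
        ∑ i, ∑ j, (if x j + 3 ≤ x i then 3 / (2 * n : ℝ) else 0) :=
      (Finset.single_le_sum (fun j _ => hT i j) (Finset.mem_univ j)).trans
        (Finset.single_le_sum (fun i _ => Finset.sum_nonneg fun j _ => hT i j) (Finset.mem_univ i))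
    rw [if_pos hij] at this
    have h4 : 2 / (n : ℝ) ^ 2 ≤ 3 / (2 * n) := by
      rw [div_le_div_iff₀ (by positivity) (by positivity)]
      nlinarith
    linarith
  · push Not at h3
    obtain ⟨i, j, hij⟩ := exists_of_not_isNash h
    have hij' : x i = x j + 2 := by have := h3 i j; omega
    obtain ⟨l, hl⟩ : ∃ l, x l = x j + 1 := by
      by_contra! hl
      refine hs ⟨x j, fun l => ?_, ⟨i, hij'⟩, ⟨j, rfl⟩⟩
      have h4 := h3 l j
      have h5 := h3 i l
      have h6 := hl l
      omega
    have h1 : 1 ≤ (above x l : ℝ) * below x l := by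
      have h4 : 0 < above x l := Finset.card_pos.2 ⟨i, by simp; omega⟩
      have h5 : 0 < below x l := Finset.card_pos.2 ⟨j, by simp; omega⟩
      exact_mod_cast Nat.mul_pos h4 h5
    have h2 : 1 ≤ ∑ i, (above x i : ℝ) * below x i :=
      h1.trans (Finset.single_le_sum (fun i _ => hA i) (Finset.mem_univ l))
    have : 2 / (n : ℝ) ^ 2 ≤ 2 / (n : ℝ) ^ 2 * ∑ i, (above x i : ℝ) * below x i :=
      le_mul_of_one_le_right (by positivity) h2
    linarith

/-! ### Leaving the split load vectors -/

open Classical in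
/-- The indicator function of the split load vectors. -/
noncomputable def splitIndicator (x : Fin n → ℕ) : ℝ := if IsSplit x then 1 else 0

lemma splitIndicator_nonneg (x : Fin n → ℕ) : 0 ≤ splitIndicator x := by
  unfold splitIndicator
  split_ifs <;> norm_num

lemma splitIndicator_le_one (x : Fin n → ℕ) : splitIndicator x ≤ 1 := by
  unfold splitIndicator
  split_ifs <;> norm_num

lemma prod_sign_eq (a : Alloc m n) (U : Finset (Fin n)) :
    ∏ b, (if a b ∈ U then (-1 : ℝ) else 1) = (-1) ^ ∑ u ∈ U, load a u := by
  rw [Finset.prod_ite, Finset.prod_const, Finset.prod_const_one, mul_one]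
  congr 1
  rw [Finset.card_eq_sum_card_fiberwise (f := a) (t := U) (fun b hb => by simpa using hb)]
  refine Finset.sum_congr rfl fun u hu => ?_
  rw [load, Finset.filter_filter]
  congr 1
  ext b
  simp only [Finset.mem_filter, Finset.mem_univ, true_and, and_iff_right_iff_imp]
  rintro rfl
  exact hu

/-- The mean parity of the total load of `U` after one round is bounded by the contribution of the
tasks on a single resource `i` of `U`. -/
lemma abs_expect_sign_le (a : Alloc m n) {U : Finset (Fin n)} {i : Fin n} (hi : i ∈ U) :
    |expect a (fun a' => (-1) ^ ∑ u ∈ U, load a' u)| ≤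
      |1 - 2 * ∑ j ∈ Uᶜ, migrateProb (load a) i j| ^ load a i := by
  have hsum : ∀ k, ∑ j, taskProb (load a) k j * (if j ∈ U then (-1 : ℝ) else 1) =
      2 * ∑ j ∈ Uᶜ, taskProb (load a) k j - 1 := by
    intro k
    have h := sum_taskProb (load a) k
    rw [← Finset.sum_add_sum_compl U] at h ⊢
    rw [Finset.sum_congr rfl fun j hj => by rw [if_pos hj],
      Finset.sum_congr (s₁ := Uᶜ) rfl fun j hj => by rw [if_neg (Finset.mem_compl.1 hj)]]
    simp only [mul_neg, mul_one, Finset.sum_neg_distrib]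
    linarith
  have hle : ∀ k, |2 * ∑ j ∈ Uᶜ, taskProb (load a) k j - 1| ≤ 1 := by
    intro k
    have h0 : 0 ≤ ∑ j ∈ Uᶜ, taskProb (load a) k j :=
      Finset.sum_nonneg fun j _ => taskProb_nonneg _ _ _
    have h1 : ∑ j ∈ Uᶜ, taskProb (load a) k j ≤ 1 := by
      rw [← sum_taskProb (load a) k]
      exact Finset.sum_le_sum_of_subset_of_nonneg (Finset.subset_univ _)
        fun j _ _ => taskProb_nonneg _ _ _
    rw [abs_le]
    constructor <;> linarith
  simp only [← prod_sign_eq]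
  rw [expect_prod a (fun _ j => if j ∈ U then (-1 : ℝ) else 1), Finset.abs_prod]
  simp only [hsum]
  have hi' : ∑ j ∈ Uᶜ, migrateProb (load a) i j = ∑ j ∈ Uᶜ, taskProb (load a) i j := by
    refine Finset.sum_congr rfl fun j hj => ?_
    rw [taskProb_of_ne]
    rintro rfl
    exact Finset.mem_compl.1 hj hi
  rw [hi', load, ← Finset.prod_const, abs_sub_comm 1]
  rw [← Finset.prod_filter_mul_prod_filter_not Finset.univ (fun b => a b = i)]
  refine (mul_le_of_le_one_right (Finset.prod_nonneg fun _ _ => abs_nonneg _)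
    (Finset.prod_le_one (fun _ _ => abs_nonneg _) fun _ _ => hle _)).trans (le_of_eq ?_)
  refine Finset.prod_congr rfl fun b hb => ?_
  rw [(Finset.mem_filter.1 hb).2]

/-- A parity estimate for `K` independent moves of probability `q` each: if at least `2 / N` of them
are expected and none is almost certain, the parity of their number is not almost certain. -/
lemma abs_one_sub_two_mul_pow_le {N q : ℝ} {K : ℕ} (hN : 2 ≤ N) (hK : 1 ≤ K)
    (h1 : 2 / N ≤ q * K) (h2 : q ≤ 1 - 1 / N) : |1 - 2 * q| ^ K ≤ 1 - 1 / N := by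
  have hN0 : 0 < N := by linarith
  have hK0 : (0 : ℝ) < K := by exact_mod_cast hK
  have hN1 : 0 < 1 / N := by positivity
  have hq : 0 < q := by
    have : 0 < q * K := lt_of_lt_of_le (by positivity) h1
    exact pos_of_mul_pos_left this hK0.le
  rcases le_total q (1 / 2) with h | h
  · rw [abs_of_nonneg (by linarith)]
    have hb : 1 + K * (2 * q) ≤ (1 + 2 * q) ^ K :=
      one_add_mul_le_pow (by linarith) K
    have hp : (1 - 2 * q) ^ K * (1 + 2 * q) ^ K ≤ 1 := by
      rw [← mul_pow]
      exact pow_le_one₀ (mul_nonneg (by linarith) (by linarith)) (by nlinarith)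
    have h0 : 0 ≤ (1 - 2 * q) ^ K := pow_nonneg (by linarith) K
    have h3 : (1 - 2 * q) ^ K * (1 + 4 * (1 / N)) ≤ 1 := by
      refine le_trans (mul_le_mul_of_nonneg_left ?_ h0) hp
      have : 4 * (1 / N) = 2 * (2 / N) := by ring
      linarith
    have h4 : 1 / N ≤ 1 / 2 := one_div_le_one_div_of_le (by norm_num) hN
    have h5 : 1 ≤ (1 - 1 / N) * (1 + 4 * (1 / N)) := by nlinarith
    exact le_of_mul_le_mul_right (h3.trans h5) (by positivity)
  · rw [abs_of_nonpos (by linarith)]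
    calc (-(1 - 2 * q)) ^ K ≤ (-(1 - 2 * q)) ^ 1 :=
          pow_le_pow_of_le_one (by linarith) (by linarith) hK
      _ ≤ 1 - 1 / N := by linarith

/-- In a split state, the tasks on a resource `i` of high load spread the parity of the total load
of any `U` containing `i` whose complement contains a resource of low load. -/
lemma abs_expect_sign_le_of_isSplit (a : Alloc m n) {k : ℕ}
    (hk : ∀ l, load a l = k ∨ load a l = k + 2) {U : Finset (Fin n)} {i j : Fin n} (hiU : i ∈ U)
    (hjU : j ∉ U) (hi : load a i = k + 2) (hj : load a j = k) :
    |expect a (fun a' => (-1) ^ ∑ u ∈ U, load a' u)| ≤ 1 - 1 / n := by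
  have hij : i ≠ j := fun h => hjU (h ▸ hiU)
  have hn2 : 2 ≤ n := by
    by_contra! hn
    exact hij (Fin.ext (by omega))
  have hn2' : (2 : ℝ) ≤ n := by exact_mod_cast hn2
  have hn0 : (0 : ℝ) < n := by linarith
  refine (abs_expect_sign_le a hiU).trans ?_
  -- A task on `i` leaves `U` by moving to one of the resources in `L`.
  set L := Uᶜ.filter fun l => load a l = k
  have hL1 : 1 ≤ L.card := Finset.card_pos.2 ⟨j, by simp [L, hjU, hj]⟩
  have hL2 : L.card + 1 ≤ n := by
    have : L.card ≤ (Finset.univ.erase i).card := Finset.card_le_card fun l hl => by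
      simp only [L, Finset.mem_filter] at hl
      refine Finset.mem_erase.2 ⟨?_, Finset.mem_univ _⟩
      rintro rfl
      omega
    rw [Finset.card_erase_of_mem (Finset.mem_univ i), Finset.card_univ, Fintype.card_fin] at this
    omega
  have hq : ∑ l ∈ Uᶜ, migrateProb (load a) i l = L.card * (1 / n * (2 / (k + 2))) := by
    rw [← nsmul_eq_mul, ← Finset.sum_const, Finset.sum_filter]
    refine Finset.sum_congr rfl fun l _ => ?_
    unfold migrateProb
    rw [hi]
    rcases hk l with h | h
    · rw [h, if_pos (by omega), if_pos rfl]
      push_cast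
      field_simp
      ring
    · rw [h, if_neg (by omega), if_neg (by omega)]
  have hL1' : (1 : ℝ) ≤ L.card := by exact_mod_cast hL1
  have hL2' : (L.card : ℝ) + 1 ≤ n := by exact_mod_cast hL2
  have hk0 : (0 : ℝ) ≤ k := Nat.cast_nonneg k
  apply abs_one_sub_two_mul_pow_le hn2' (by omega)
  · rw [hq, hi]
    push_cast
    calc (2 / n : ℝ) ≤ L.card * (2 / n) := le_mul_of_one_le_left (by positivity) hL1'
      _ = _ := by field_simp
  · rw [hq]
    have h1 : (2 : ℝ) / (k + 2) ≤ 1 := by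
      rw [div_le_one (by positivity)]
      linarith
    calc L.card * (1 / n * (2 / (k + 2)) : ℝ) ≤ L.card * (1 / n * 1) := by gcongr
      _ ≤ (n - 1) * (1 / n * 1) := by
        gcongr
        linarith
      _ = 1 - 1 / n := by field_simp

/-- All loads of a split vector have the same parity, whereas one round makes the parity of the
loads random: a split state is left with probability at least `1 / (2 n)`. -/
lemma expect_splitIndicator_le (a : Alloc m n) (h : IsSplit (load a)) :
    expect a (fun a' => splitIndicator (load a')) ≤ 1 - 1 / (2 * n) := by
  obtain ⟨k, hk, ⟨i, hi⟩, j, hj⟩ := h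
  have hij : i ≠ j := by
    rintro rfl
    omega
  -- With a third resource `v`, the total load of `{i, v}` is even in every split state; with two
  -- resources only, `k` is determined by `m`, hence so is the parity of the load of `i`.
  obtain ⟨U, s, hiU, hjU, hs, hU⟩ : ∃ (U : Finset (Fin n)) (s : ℝ), i ∈ U ∧ j ∉ U ∧ |s| = 1 ∧
      ∀ a' : Alloc m n, IsSplit (load a') → (-1 : ℝ) ^ ∑ u ∈ U, load a' u = s := by
    rcases lt_or_ge 2 n with hn | hn
    · obtain ⟨v, -, hv⟩ := Finset.exists_mem_notMem_of_card_lt_card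
        (s := {i, j}) (t := Finset.univ) (lt_of_le_of_lt Finset.card_le_two (by simpa using hn))
      simp only [Finset.mem_insert, Finset.mem_singleton, not_or] at hv
      refine ⟨{i, v}, 1, by simp, by simp [hij.symm, Ne.symm hv.2], by simp, ?_⟩
      rintro a' ⟨k', hk', -⟩
      rw [Finset.sum_pair (Ne.symm hv.1)]
      apply Even.neg_one_pow
      rw [Nat.even_iff]
      have h1 := hk' i
      have h2 := hk' v
      omega
    · have hpair : ∀ a' : Alloc m n, load a' i + load a' j = m := by
        intro a'
        have h1 : ∑ l, load a' l = m := by exact_mod_cast sum_load a'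
        refine Eq.trans ?_ h1
        rw [← Finset.sum_pair (f := load a') hij]
        congr 1
        refine Finset.eq_univ_of_card _ (le_antisymm (Finset.card_le_univ _) ?_)
        rw [Finset.card_pair hij, Fintype.card_fin]
        exact hn
      have huniv : ∀ l, l = i ∨ l = j := by
        intro l
        by_contra! hl
        have h1 := i.isLt
        have h2 := j.isLt
        have h3 := l.isLt
        simp only [ne_eq, Fin.ext_iff] at hl hij
        omega
      refine ⟨{i}, (-1) ^ k, by simp, by simpa using hij.symm, by simp, ?_⟩
      rintro a' ⟨k', hk', ⟨i', hi'⟩, j', hj'⟩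
      rw [Finset.sum_singleton, neg_one_pow_eq_pow_mod_two, neg_one_pow_eq_pow_mod_two (n := k)]
      congr 1
      have h1 := hpair a
      have h2 := hpair a'
      rcases huniv i' with rfl | rfl <;> rcases huniv j' with rfl | rfl <;> omega
  have hb := abs_expect_sign_le_of_isSplit a hk hiU hjU hi hj
  have hle : ∀ a' : Alloc m n,
      splitIndicator (load a') ≤ 1 / 2 + s / 2 * (-1) ^ ∑ u ∈ U, load a' u := by
    intro a'
    unfold splitIndicator
    split_ifs with h
    · rw [hU a' h]
      have : s * s = 1 := by rw [← abs_mul_abs_self, hs, one_mul]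
      linarith
    · have h1 : |s * (-1 : ℝ) ^ ∑ u ∈ U, load a' u| = 1 := by simp [abs_mul, hs]
      have := neg_le_of_abs_le h1.le
      linarith
  refine (expect_mono a hle).trans ?_
  rw [expect_add, expect_const, expect_const_mul]
  have h1 : s * expect a (fun a' => (-1) ^ ∑ u ∈ U, load a' u) ≤ 1 - 1 / n := by
    refine (le_abs_self _).trans ?_
    rw [abs_mul, hs, one_mul]
    exact hb
  have h2 : (1 : ℝ) / (2 * n) = 1 / n / 2 := by ring
  rw [h2]
  linarith

/-! ### A Lyapunov function -/

/-- The iterated logarithm of the potential, which measures the number of rounds in which the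
potential comes down to order `n`. -/
noncomputable def logPotential (x : Fin n → ℕ) : ℝ :=
  Real.log (1 + Real.log (1 + potential x / n))

/-- The Lyapunov function. Its first part decreases in expectation as long as the potential is of
order `n`, with the correction `splitIndicator` taking care of split vectors; its second part
decreases in expectation when the potential is larger. -/
noncomputable def lyapunov (x : Fin n → ℕ) : ℝ :=
  2 * (n : ℝ) ^ 3 * min (potential x + 1 / (n : ℝ) ^ 2 * splitIndicator x) (256 * n : ℝ) +
    4 * logPotential x

lemma log_one_add_nonneg {u : ℝ} (hu : 0 ≤ u) : 0 ≤ Real.log (1 + u) :=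
  Real.log_nonneg (by linarith)

lemma logPotential_nonneg (x : Fin n → ℕ) : 0 ≤ logPotential x :=
  log_one_add_nonneg (log_one_add_nonneg (div_nonneg (potential_nonneg x) (Nat.cast_nonneg n)))

lemma lyapunov_nonneg (x : Fin n → ℕ) : 0 ≤ lyapunov x := by
  have h1 := potential_nonneg x
  have h2 := splitIndicator_nonneg x
  have h3 := logPotential_nonneg x
  unfold lyapunov
  positivity

lemma expect_nonneg (a : Alloc m n) {f : Alloc m n → ℝ} (hf : ∀ a', 0 ≤ f a') :
    0 ≤ expect a f :=
  Finset.sum_nonneg fun a' _ => mul_nonneg (stepProb_nonneg a a') (hf a')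

lemma expect_log_one_add_le (a : Alloc m n) {f : Alloc m n → ℝ} (hf : ∀ a', 0 ≤ f a') :
    expect a (fun a' => Real.log (1 + f a')) ≤ Real.log (1 + expect a f) := by
  have h := expect_le_of_concaveOn strictConcaveOn_log_Ioi.concaveOn a (f := fun a' => 1 + f a')
    (fun a' => by
      have := hf a'
      simp only [Set.mem_Ioi]
      linarith)
  rwa [expect_add, expect_one] at h

lemma expect_logPotential_le (a : Alloc m n) :
    expect a (fun a' => logPotential (load a')) ≤
      Real.log (1 + Real.log (1 + expect a (fun a' => potential (load a')) / n)) := by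
  have h0 : ∀ a' : Alloc m n, 0 ≤ potential (load a') / n :=
    fun a' => div_nonneg (potential_nonneg _) (Nat.cast_nonneg n)
  unfold logPotential
  refine (expect_log_one_add_le a fun a' => log_one_add_nonneg (h0 a')).trans ?_
  have h1 := expect_log_one_add_le a h0
  have h2 : expect a (fun a' => potential (load a') / n) =
      expect a (fun a' => potential (load a')) / n := by
    simp only [div_eq_inv_mul, expect_const_mul]
  rw [h2] at h1
  have h3 := expect_nonneg a fun a' => log_one_add_nonneg (h0 a')
  exact Real.log_le_log (by linarith) (by linarith)

lemma expect_logPotential_le_self (hn : 0 < n) (a : Alloc m n) :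
    expect a (fun a' => logPotential (load a')) ≤ logPotential (load a) := by
  refine (expect_logPotential_le a).trans ?_
  have h := expect_potential_le_self hn a
  have h0 : 0 ≤ expect a (fun a' => potential (load a')) / n :=
    div_nonneg (expect_nonneg a fun a' => potential_nonneg _) (Nat.cast_nonneg n)
  have h1 := log_one_add_nonneg h0
  unfold logPotential
  gcongr

/-- Taking the square root of `u` essentially halves its logarithm. -/
lemma one_add_log_le {u : ℝ} (hu : 255 ≤ u) :
    1 + Real.log (1 + (1 + √(2 * u))) ≤ 3 / 4 * (1 + Real.log (1 + u)) := by
  have hs := Real.sq_sqrt (show 0 ≤ 2 * u by linarith)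
  have hs0 := Real.sqrt_nonneg (2 * u)
  have h1 : 2 * Real.log (1 + (1 + √(2 * u))) ≤ 3 * Real.log 2 + Real.log (1 + u) := by
    calc 2 * Real.log (1 + (1 + √(2 * u))) = Real.log ((1 + (1 + √(2 * u))) ^ 2) := by
          rw [Real.log_pow]; norm_num
      _ ≤ Real.log (2 ^ 3 * (1 + u)) :=
          Real.log_le_log (by positivity) (by nlinarith [sq_nonneg (√(2 * u) - 2)])
      _ = _ := by
          rw [Real.log_mul (by norm_num) (by linarith), Real.log_pow]
          norm_num
  have h2 : 8 * Real.log 2 ≤ Real.log (1 + u) := by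
    calc 8 * Real.log 2 = Real.log (2 ^ 8) := by rw [Real.log_pow]; norm_num
      _ ≤ _ := Real.log_le_log (by norm_num) (by linarith)
  have h3 := Real.log_two_gt_d9
  linarith

lemma expect_logPotential_le_sub (hn : 0 < n) (a : Alloc m n)
    (h : 255 * n ≤ potential (load a)) :
    expect a (fun a' => logPotential (load a')) ≤ logPotential (load a) - 1 / 4 := by
  have hn' : (0 : ℝ) < n := by positivity
  refine (expect_logPotential_le a).trans ?_
  set u := potential (load a) / n with hu
  have hu255 : 255 ≤ u := (le_div_iff₀ hn').2 h
  have h0 : 0 ≤ expect a (fun a' => potential (load a')) / n :=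
    div_nonneg (expect_nonneg a fun a' => potential_nonneg _) (Nat.cast_nonneg n)
  have h1 : expect a (fun a' => potential (load a')) / n ≤ 1 + √(2 * u) := by
    rw [div_le_iff₀ hn']
    refine (expect_potential_le_sqrt hn a).trans (le_of_eq ?_)
    have h2 : 2 * n * potential (load a) = 2 * u * (n : ℝ) ^ 2 := by
      rw [hu]; field_simp
    rw [h2, Real.sqrt_mul (by positivity), Real.sqrt_sq hn'.le]
    ring
  have h3 : Real.log (1 + expect a (fun a' => potential (load a')) / n) ≤
      Real.log (1 + (1 + √(2 * u))) := Real.log_le_log (by linarith) (by linarith)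
  have h4 := one_add_log_le hu255
  have h5 := log_one_add_nonneg h0
  have h6 : 0 ≤ Real.log (1 + u) := log_one_add_nonneg (by linarith)
  have h7 : Real.log (3 / 4) ≤ -(1 / 4) := by
    have := Real.log_le_sub_one_of_pos (show (0 : ℝ) < 3 / 4 by norm_num)
    linarith
  calc _ ≤ Real.log (3 / 4 * (1 + Real.log (1 + u))) := Real.log_le_log (by linarith) (by linarith)
    _ = Real.log (3 / 4) + Real.log (1 + Real.log (1 + u)) :=
        Real.log_mul (by norm_num) (by linarith)
    _ ≤ _ := by
        rw [logPotential, ← hu]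
        linarith

/-- Outside equilibrium, the potential corrected on split vectors drops in expectation by at least
`1 / (2 n ^ 3)`. -/
lemma expect_potential_add_splitIndicator_le (a : Alloc m n) (h : ¬ IsNash (load a)) :
    expect a (fun a' => potential (load a') + 1 / (n : ℝ) ^ 2 * splitIndicator (load a')) ≤
      potential (load a) + 1 / (n : ℝ) ^ 2 * splitIndicator (load a) - 1 / (2 * (n : ℝ) ^ 3) := by
  have hn2 := two_le_of_not_isNash h
  have hn2' : (2 : ℝ) ≤ n := by exact_mod_cast hn2
  have hsq : (0 : ℝ) < 1 / (n : ℝ) ^ 2 := by positivity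
  rw [expect_add, expect_const_mul]
  by_cases hs : IsSplit (load a)
  · have h1 := expect_potential_le_self (by omega) a
    have h2 := mul_le_mul_of_nonneg_left (expect_splitIndicator_le a hs) hsq.le
    have h3 : 1 / (n : ℝ) ^ 2 * (1 - 1 / (2 * n)) = 1 / (n : ℝ) ^ 2 - 1 / (2 * (n : ℝ) ^ 3) := by
      field_simp
    have h4 : splitIndicator (load a) = 1 := by simp [splitIndicator, hs]
    rw [h4]
    linarith
  · have h1 := expect_potential_le_of_not_isSplit a h hs
    have h2 : expect a (fun a' => splitIndicator (load a')) ≤ 1 :=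
      (expect_mono a fun a' => splitIndicator_le_one _).trans (expect_one a).le
    have h3 := mul_le_mul_of_nonneg_left h2 hsq.le
    have h4 : splitIndicator (load a) = 0 := by simp [splitIndicator, hs]
    have h5 : 1 / (2 * (n : ℝ) ^ 3) ≤ 1 / (n : ℝ) ^ 2 := by
      apply one_div_le_one_div_of_le (by positivity)
      nlinarith [sq_nonneg (n : ℝ), mul_nonneg (sq_nonneg (n : ℝ)) (by linarith : (0 : ℝ) ≤ n)]
    have h6 : 2 / (n : ℝ) ^ 2 = 2 * (1 / (n : ℝ) ^ 2) := by ring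
    rw [h4]
    linarith

lemma expect_lyapunov_le (a : Alloc m n) (h : ¬ IsNash (load a)) :
    expect a (fun a' => lyapunov (load a')) ≤ lyapunov (load a) - 1 := by
  have hn2 := two_le_of_not_isNash h
  have hn2' : (2 : ℝ) ≤ n := by exact_mod_cast hn2
  have hn : 0 < n := by omega
  unfold lyapunov
  rw [expect_add, expect_const_mul, expect_const_mul]
  set Ψ : (Fin n → ℕ) → ℝ := fun x => potential x + 1 / (n : ℝ) ^ 2 * splitIndicator x with hΨ
  have hmin : expect a (fun a' => min (Ψ (load a')) (256 * n : ℝ)) ≤ 256 * n :=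
    (expect_mono a fun a' => min_le_right _ _).trans (expect_const a _).le
  have hn3 : (0 : ℝ) < 2 * (n : ℝ) ^ 3 := by positivity
  change 2 * (n : ℝ) ^ 3 * expect a (fun a' => min (Ψ (load a')) (256 * n : ℝ)) + _ ≤
    2 * (n : ℝ) ^ 3 * min (Ψ (load a)) (256 * n : ℝ) + _ - 1
  rcases le_total (Ψ (load a)) (256 * n : ℝ) with hle | hle
  · have h1 : expect a (fun a' => min (Ψ (load a')) (256 * n : ℝ)) ≤
        Ψ (load a) - 1 / (2 * (n : ℝ) ^ 3) :=
      (expect_mono a fun a' => min_le_left _ _).trans (expect_potential_add_splitIndicator_le a h)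
    have h2 := mul_le_mul_of_nonneg_left h1 hn3.le
    rw [mul_sub, mul_one_div_cancel hn3.ne'] at h2
    have h3 := expect_logPotential_le_self hn a
    rw [min_eq_left hle]
    linarith
  -- Here the first part is at its maximum, and the potential itself is at least `255 n`.
  · have h1 := mul_le_mul_of_nonneg_left hmin hn3.le
    have h2 : 1 / (n : ℝ) ^ 2 * splitIndicator (load a) ≤ 1 := by
      refine mul_le_one₀ ?_ (splitIndicator_nonneg _) (splitIndicator_le_one _)
      rw [div_le_one (by positivity)]
      nlinarith
    have h3 := expect_logPotential_le_sub hn a (by simp only [hΨ] at hle; linarith)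
    rw [min_eq_right hle]
    linarith

lemma neg_half_le_log_log {m : ℕ} (hm : 2 ≤ m) : -(1 / 2) ≤ Real.log (Real.log m) := by
  have hm' : (2 : ℝ) ≤ m := by exact_mod_cast hm
  have h1 : Real.log 2 ≤ Real.log m := Real.log_le_log (by norm_num) hm'
  have h2 := Real.log_two_gt_d9
  have h3 := Real.one_sub_inv_le_log_of_pos (show 0 < Real.log m by linarith)
  have h4 : (Real.log m)⁻¹ ≤ (2 / 3)⁻¹ := inv_anti₀ (by norm_num) (by linarith)
  norm_num at h4
  linarith

lemma logPotential_load_le (hn : 0 < n) (hm : 2 ≤ m) (a : Alloc m n) :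
    logPotential (load a) ≤ Real.log (Real.log m) + 2 := by
  have hm' : (2 : ℝ) ≤ m := by exact_mod_cast hm
  have hn' : (1 : ℝ) ≤ n := by exact_mod_cast hn
  have h1 : potential (load a) ≤ (m : ℝ) ^ 2 := by
    rw [potential_eq hn, sum_load]
    have h2 : ∑ i, (load a i : ℝ) ^ 2 ≤ (∑ i, (load a i : ℝ)) ^ 2 :=
      Finset.sum_sq_le_sq_sum_of_nonneg fun i _ => Nat.cast_nonneg _
    rw [sum_load] at h2
    have h3 : 0 ≤ (m : ℝ) ^ 2 / n := by positivity
    linarith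
  have h0 := potential_nonneg (load a)
  have h2 : potential (load a) / n ≤ (m : ℝ) ^ 2 := (div_le_self h0 hn').trans h1
  have h3 : Real.log (1 + potential (load a) / n) ≤ 3 * Real.log m := by
    calc _ ≤ Real.log ((m : ℝ) ^ 3) := by
          apply Real.log_le_log
          · positivity
          · nlinarith
      _ = _ := by rw [Real.log_pow]; norm_num
  have h4 : Real.log 2 ≤ Real.log m := Real.log_le_log (by norm_num) hm'
  have h5 := Real.log_two_gt_d9
  have h6 := log_one_add_nonneg (div_nonneg h0 (by linarith : (0 : ℝ) ≤ n))
  have h7 : Real.log 5 ≤ 2 := by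
    rw [Real.log_le_iff_le_exp (by norm_num)]
    have h8 := Real.exp_one_gt_d9
    have h9 : Real.exp 2 = Real.exp 1 ^ 2 := by rw [← Real.exp_nat_mul]; norm_num
    rw [h9]
    nlinarith
  calc logPotential (load a) ≤ Real.log (5 * Real.log m) :=
        Real.log_le_log (by linarith) (by linarith)
    _ = Real.log 5 + Real.log (Real.log m) := Real.log_mul (by norm_num) (by linarith)
    _ ≤ _ := by linarith

/-- The constant leaves room for `log log m` being negative if `m = 2`. -/
lemma lyapunov_load_le (hn : 0 < n) (hm : 2 ≤ m) (a : Alloc m n) :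
    lyapunov (load a) ≤ 2000 * (Real.log (Real.log m) + (n : ℝ) ^ 4) := by
  have h1 := logPotential_load_le hn hm a
  have h2 := neg_half_le_log_log hm
  have h3 : (1 : ℝ) ≤ (n : ℝ) ^ 4 := one_le_pow₀ (by exact_mod_cast hn)
  have h4 : 2 * (n : ℝ) ^ 3 *
      min (potential (load a) + 1 / (n : ℝ) ^ 2 * splitIndicator (load a)) (256 * n : ℝ) ≤
        2 * (n : ℝ) ^ 3 * (256 * n) := by
    gcongr
    exact min_le_right _ _
  have h5 : 2 * (n : ℝ) ^ 3 * (256 * n) = 512 * (n : ℝ) ^ 4 := by ring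
  unfold lyapunov
  linarith

/-! ### The hitting time of equilibrium -/

/-- The event that no equilibrium has been seen up to time `t`. -/
def Unsettled {Ω : Type*} (A : ℕ → Ω → Alloc m n) (t : ℕ) : Set Ω :=
  {ω | ∀ s ≤ t, ¬ IsNash (load (A s ω))}

lemma nashTime_le_tsum {Ω : Type*} (A : ℕ → Ω → Alloc m n) (ω : Ω) :
    nashTime A ω ≤ ∑' t, (Unsettled A t).indicator 1 ω := by
  classical
  by_cases h : ∃ t, IsNash (load (A t ω))
  · calc nashTime A ω ≤ (Nat.find h : ℝ≥0∞) :=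
        iInf₂_le (f := fun (t : ℕ) (_ : IsNash (load (A t ω))) => (t : ℝ≥0∞)) _ (Nat.find_spec h)
      _ = ∑ t ∈ Finset.range (Nat.find h), (Unsettled A t).indicator 1 ω := by
          rw [Finset.sum_congr rfl fun t ht => Set.indicator_of_mem
            (show ω ∈ Unsettled A t from fun s hs =>
              Nat.find_min h (lt_of_le_of_lt hs (Finset.mem_range.1 ht))) 1]
          simp
      _ ≤ _ := ENNReal.sum_le_tsum _
  · push Not at h
    have : ∀ t, (Unsettled A t).indicator (1 : Ω → ℝ≥0∞) ω = 1 := fun t =>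
      Set.indicator_of_mem (show ω ∈ Unsettled A t from fun s _ => h s) 1
    simp [this]

section HittingTime

variable {Ω : Type*} [MeasurableSpace Ω] {μ : Measure Ω} {A : ℕ → Ω → Alloc m n}

lemma IsProtocolRun.measurableSet_eq (h : IsProtocolRun μ A) (t : ℕ) (a : Alloc m n) :
    MeasurableSet {ω | A t ω = a} := h.measurable t (measurableSet_singleton a)

lemma IsProtocolRun.measurableSet_unsettled (h : IsProtocolRun μ A) (t : ℕ) :
    MeasurableSet (Unsettled A t) := by
  have : Unsettled A t = ⋂ s, ⋂ (_ : s ≤ t), A s ⁻¹' {a | ¬ IsNash (load a)} := by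
    ext ω
    simp [Unsettled]
  rw [this]
  exact MeasurableSet.iInter fun s => MeasurableSet.iInter fun _ =>
    h.measurable s (Set.toFinite _).measurableSet

variable [IsProbabilityMeasure μ]

open Classical in
/-- Decomposition of an event according to the history up to time `t`. -/
lemma IsProtocolRun.real_unsettled_inter_eq_sum (h : IsProtocolRun μ A) (t : ℕ) (a : Alloc m n)
    {S : Set Ω} (hS : MeasurableSet S) :
    μ.real (Unsettled A t ∩ {ω | A t ω = a} ∩ S) =
      ∑ g ∈ Finset.univ.filter (fun g : Fin (t + 1) → Alloc m n =>
          (∀ s, ¬ IsNash (load (g s))) ∧ g (Fin.last t) = a),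
        μ.real ({ω | ∀ s ≤ t, A s ω = g (Fin.ofNat (t + 1) s)} ∩ S) := by
  rw [← measureReal_biUnion_finset]
  · congr 1
    ext ω
    simp only [Set.mem_inter_iff, Set.mem_iUnion, Set.mem_ofPred_eq, Unsettled,
      Finset.mem_filter, Finset.mem_univ, true_and, exists_prop]
    constructor
    · rintro ⟨⟨h1, h2⟩, h3⟩
      refine ⟨fun s => A s ω, ⟨fun s => h1 s (Nat.lt_succ_iff.1 s.isLt), by simpa using h2⟩,
        fun s hs => ?_, h3⟩
      simp [Fin.ofNat, Nat.mod_eq_of_lt (Nat.lt_succ_of_le hs)]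
    · rintro ⟨g, ⟨h1, h2⟩, h3, h4⟩
      refine ⟨⟨fun s hs => ?_, ?_⟩, h4⟩
      · rw [h3 s hs]
        exact h1 _
      · rw [h3 t le_rfl, ← h2]
        congr 1
        ext
        simp [Fin.ofNat]
  · intro g _ g' _ hgg'
    rw [Function.onFun, Set.disjoint_left]
    rintro ω ⟨h1, -⟩ ⟨h2, -⟩
    apply hgg'
    ext1 s
    have hs : Fin.ofNat (t + 1) (s : ℕ) = s := by
      ext
      simp [Fin.ofNat, Nat.mod_eq_of_lt s.isLt]
    have h3 := h1 s (Nat.lt_succ_iff.1 s.isLt)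
    have h4 := h2 s (Nat.lt_succ_iff.1 s.isLt)
    rw [hs] at h3 h4
    exact h3.symm.trans h4
  · intro g _
    refine MeasurableSet.inter ?_ hS
    have : {ω | ∀ s ≤ t, A s ω = g (Fin.ofNat (t + 1) s)} =
        ⋂ s, ⋂ (_ : s ≤ t), {ω | A s ω = g (Fin.ofNat (t + 1) s)} := by
      ext ω
      simp
    rw [this]
    exact MeasurableSet.iInter fun s => MeasurableSet.iInter fun _ => h.measurableSet_eq s _

/-- The Markov property on the event that no equilibrium has been seen. -/
lemma IsProtocolRun.real_unsettled_inter_succ (h : IsProtocolRun μ A) (t : ℕ) (a a' : Alloc m n) :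
    μ.real (Unsettled A t ∩ {ω | A t ω = a} ∩ {ω | A (t + 1) ω = a'}) =
      μ.real (Unsettled A t ∩ {ω | A t ω = a}) * stepProb a a' := by
  classical
  have h1 := h.real_unsettled_inter_eq_sum t a MeasurableSet.univ
  simp only [Set.inter_univ] at h1
  rw [h.real_unsettled_inter_eq_sum t a (h.measurableSet_eq (t + 1) a'), h1, Finset.sum_mul]
  refine Finset.sum_congr rfl fun g hg => ?_
  have hlast : g (Fin.ofNat (t + 1) t) = a := by
    rw [← (Finset.mem_filter.1 hg).2.2]
    congr 1
    ext
    simp [Fin.ofNat]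
  have h2 := h.markov t (fun s => g (Fin.ofNat (t + 1) s)) a'
  rw [hlast] at h2
  exact h2

/-- Foster's criterion: a bounded nonnegative function that drops by one in expectation in every
round outside equilibrium bounds the expected time to reach equilibrium. -/
lemma IsProtocolRun.lintegral_nashTime_le (h : IsProtocolRun μ A) {G : Alloc m n → ℝ} {M : ℝ}
    (hG0 : ∀ a, 0 ≤ G a) (hGM : ∀ a, G a ≤ M)
    (hG : ∀ a, ¬ IsNash (load a) → expect a G ≤ G a - 1) :
    ∫⁻ ω, nashTime A ω ∂μ ≤ ENNReal.ofReal M := by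
  set q : ℕ → Alloc m n → ℝ := fun t a => μ.real (Unsettled A t ∩ {ω | A t ω = a}) with hq
  have hq0 : ∀ t a, 0 ≤ q t a := fun t a => measureReal_nonneg
  have hsum : ∀ t, ∑ a, q t a = μ.real (Unsettled A t) := by
    intro t
    rw [← measureReal_biUnion_finset]
    · congr 1
      ext ω
      simp
    · intro a _ a' _ haa'
      rw [Function.onFun, Set.disjoint_left]
      rintro ω ⟨-, h1⟩ ⟨-, h2⟩
      exact haa' (h1.symm.trans h2)
    · exact fun a _ => (h.measurableSet_unsettled t).inter (h.measurableSet_eq t a)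
  have hstep : ∀ t a', q (t + 1) a' ≤ ∑ a, q t a * stepProb a a' := by
    intro t a'
    simp only [hq, ← h.real_unsettled_inter_succ]
    refine le_trans (measureReal_mono ?_ (measure_ne_top _ _)) (measureReal_biUnion_finset_le _ _)
    rintro ω ⟨h1, h2⟩
    simp only [Set.mem_iUnion]
    exact ⟨A t ω, Finset.mem_univ _, ⟨fun s hs => h1 s (by omega), rfl⟩, h2⟩
  have hdrop : ∀ t, ∑ a, q (t + 1) a * G a ≤ ∑ a, q t a * G a - μ.real (Unsettled A t) := by
    intro t
    calc ∑ a', q (t + 1) a' * G a' ≤ ∑ a', (∑ a, q t a * stepProb a a') * G a' :=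
          Finset.sum_le_sum fun a' _ => mul_le_mul_of_nonneg_right (hstep t a') (hG0 a')
      _ = ∑ a, q t a * expect a G := by
          simp only [expect, Finset.mul_sum, Finset.sum_mul, mul_assoc]
          exact Finset.sum_comm
      _ ≤ ∑ a, q t a * (G a - 1) := by
          refine Finset.sum_le_sum fun a _ => ?_
          by_cases ha : IsNash (load a)
          · have : q t a = 0 := by
              have hempty : Unsettled A t ∩ {ω | A t ω = a} = ∅ := by
                ext ω
                simp only [Set.mem_inter_iff, Set.mem_ofPred_eq, Set.mem_empty_iff_false,
                  iff_false, not_and]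
                rintro h1 rfl
                exact h1 t le_rfl ha
              simp [hq, hempty]
            simp [this]
          · exact mul_le_mul_of_nonneg_left (hG a ha) (hq0 t a)
      _ = _ := by
          rw [← hsum]
          simp [mul_sub, Finset.sum_sub_distrib]
  have hpartial : ∀ N, ∑ t ∈ Finset.range N, μ.real (Unsettled A t) ≤
      ∑ a, q 0 a * G a - ∑ a, q N a * G a := by
    intro N
    induction N with
    | zero => simp
    | succ N ih =>
      rw [Finset.sum_range_succ]
      linarith [hdrop N]
  have hM : ∀ N, ∑ t ∈ Finset.range N, μ.real (Unsettled A t) ≤ M := by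
    intro N
    have hN : 0 ≤ ∑ a, q N a * G a := Finset.sum_nonneg fun a _ => mul_nonneg (hq0 N a) (hG0 a)
    have h0 : ∑ a, q 0 a * G a ≤ ∑ a, q 0 a * M :=
      Finset.sum_le_sum fun a _ => mul_le_mul_of_nonneg_left (hGM a) (hq0 0 a)
    rw [← Finset.sum_mul, hsum] at h0
    obtain ⟨ω⟩ : Nonempty Ω := nonempty_of_isProbabilityMeasure μ
    have hM0 : 0 ≤ M := (hG0 (A 0 ω)).trans (hGM _)
    have h1 : μ.real (Unsettled A 0) * M ≤ 1 * M :=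
      mul_le_mul_of_nonneg_right measureReal_le_one hM0
    linarith [hpartial N]
  calc ∫⁻ ω, nashTime A ω ∂μ ≤ ∫⁻ ω, ∑' t, (Unsettled A t).indicator 1 ω ∂μ :=
        lintegral_mono (nashTime_le_tsum A)
    _ = ∑' t, μ (Unsettled A t) := by
        rw [lintegral_tsum fun t =>
          (measurable_one.indicator (h.measurableSet_unsettled t)).aemeasurable]
        simp only [lintegral_indicator_one (h.measurableSet_unsettled _)]
    _ ≤ ENNReal.ofReal M := by
        refine ENNReal.tsum_le_of_sum_range_le fun N => ?_
        have h1 : ∀ t, μ (Unsettled A t) = ENNReal.ofReal (μ.real (Unsettled A t)) :=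
          fun t => (ofReal_measureReal).symm
        simp only [h1]
        rw [← ENNReal.ofReal_sum_of_nonneg fun t _ => measureReal_nonneg]
        exact ENNReal.ofReal_le_ofReal (hM N)

end HittingTime

end SelfishLoadBalancing

theorem theorem1 :
    ∃ C : ℝ, 0 < C ∧
      ∀ (n m : ℕ), 1 ≤ n → 2 ≤ m →
      ∀ (Ω : Type*) [MeasurableSpace Ω] (μ : Measure Ω) [IsProbabilityMeasure μ]
        (A : ℕ → Ω → SelfishLoadBalancing.Alloc m n),
        SelfishLoadBalancing.IsProtocolRun μ A →
        ∫⁻ ω, SelfishLoadBalancing.nashTime A ω ∂μ ≤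
          ENNReal.ofReal (C * (Real.log (Real.log (m : ℝ)) + (n : ℝ) ^ 4)) := by
  refine ⟨2000, by norm_num, fun n m hn hm Ω _ μ _ A hA => ?_⟩
  exact hA.lintegral_nashTime_le (G := fun a => SelfishLoadBalancing.lyapunov
      (SelfishLoadBalancing.load a))
    (fun a => SelfishLoadBalancing.lyapunov_nonneg _)
    (fun a => SelfishLoadBalancing.lyapunov_load_le hn hm a)
    SelfishLoadBalancing.expect_lyapunov_le
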